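/- A \emph{composition} is a structure $(M, E, \prec_1)$, where $E$ is an equivalence relation on $M$ and $\prec_1$ is a (strict) linear order on the $E$-classes, regarded as a relation on points: $\prec_1$ is a strict partial order on $M$, two points are $\prec_1$-comparable if and only if they are not $E$-related, and $a \mathrel{E} a'$, $a \prec_1 b$ imply $a' \prec_1 b$. Equivalently, a composition is the reduct to the language $\{E, \prec_1\}$ of a \emph{fractured order}, that is, of a structure $(M, E, \prec_1, \prec_2)$ such that $\prec_1$ and $\prec_2$ are strict partial orders, $E$ is an equivalence relation, distinct points are $\prec_1$-comparable if and only if they are not $E$-related, distinct points are $\prec_2$-comparable if and only if they are $E$-related, and $a \mathrel{E} a'$, $a \prec_1 b$ imply $a' \prec_1 b$. \textbf{Theorem.} Compositions admit an unlabeled logical limit law: for every first-order sentence $\varphi$ (with equality) in the language $\{E, \prec_1\}$, the proportion $$\frac{\#\{\text{isomorphism classes of compositions on } \{1,\dots,n\} \text{ satisfying } \varphi\}}{\#\{\text{isomorphism classes of compositions on } \{1,\dots,n\}\}}$$ converges as $n \to \infty$ (the denominator being finite and nonzero for all large $n$). -/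

import Mathlib

open Filter Topology
open scoped FirstOrder

namespace LogicalLimitLaw

/-! ### Unlabeled logical limit laws for classes of structures -/

section LimitLaw

/-- Isomorphism of `L`-structures on `Fin n`, restricted to the structures that belong to the
class `K`. -/
def isoSetoid {L : FirstOrder.Language.{0, 0}} (K : ∀ M : Type, L.Structure M → Prop) (n : ℕ) :
    Setoid {S : L.Structure (Fin n) // K (Fin n) S} where
  r S T := Nonempty (@FirstOrder.Language.Equiv L (Fin n) (Fin n) S.1 T.1)
  iseqv :=
    { refl := fun S => ⟨@FirstOrder.Language.Equiv.refl L (Fin n) S.1⟩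
      symm := fun {S T} ⟨e⟩ => ⟨@FirstOrder.Language.Equiv.symm L (Fin n) (Fin n) S.1 T.1 e⟩
      trans := fun {S T U} ⟨e⟩ ⟨f⟩ =>
        ⟨@FirstOrder.Language.Equiv.comp L (Fin n) (Fin n) S.1 T.1 (Fin n) U.1 f e⟩ }

/-- The unlabeled structures of size `n` in the class `K`: the members of `K` with universe `Fin n`,
up to isomorphism. -/
def UnlabeledStructure {L : FirstOrder.Language.{0, 0}} (K : ∀ M : Type, L.Structure M → Prop) (n : ℕ) :
    Type :=
  Quotient (isoSetoid K n)

/-- An unlabeled structure satisfies the first-order sentence `φ` (well defined, since isomorphic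
structures satisfy the same sentences). -/
def UnlabeledStructure.Satisfies {L : FirstOrder.Language.{0, 0}} {K : ∀ M : Type, L.Structure M → Prop}
    {n : ℕ} (c : UnlabeledStructure K n) (φ : L.Sentence) : Prop :=
  Quotient.lift (s := isoSetoid K n)
    (fun S => @FirstOrder.Language.Sentence.Realize L (Fin n) S.1 φ)
    (fun S T ⟨e⟩ => propext
      (@FirstOrder.Language.StrongHomClass.realize_sentence L (Fin n) (Fin n) S.1 T.1 _ _ _ e φ))
    c

/-- The probability that a uniformly random unlabeled structure of size `n` in the class `K`
satisfies `φ`. -/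
noncomputable def unlabeledProbability {L : FirstOrder.Language.{0, 0}}
    (K : ∀ M : Type, L.Structure M → Prop) (φ : L.Sentence) (n : ℕ) : ℝ :=
  (Nat.card {c : UnlabeledStructure K n // c.Satisfies φ} : ℝ) /
    (Nat.card (UnlabeledStructure K n) : ℝ)

/-- The class `K` admits an unlabeled logical limit law: for each first-order sentence `φ`, the
probability that a uniformly random unlabeled structure of size `n` in `K` satisfies `φ` converges
as `n → ∞`. The first part says that, for all large `n`, these probabilities make sense. -/
def AdmitsUnlabeledLimitLaw {L : FirstOrder.Language.{0, 0}} (K : ∀ M : Type, L.Structure M → Prop) : Prop :=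
  (∀ᶠ n in atTop, Finite (UnlabeledStructure K n) ∧ Nonempty (UnlabeledStructure K n)) ∧
    ∀ φ : L.Sentence, ∃ p : ℝ, Tendsto (unlabeledProbability K φ) atTop (𝓝 p)

end LimitLaw

/-! ### Fractured orders -/

/-- The relation symbols `E`, `≺₁`, `≺₂`, all binary. -/
inductive FracturedRel : ℕ → Type
  | equiv : FracturedRel 2
  | prec₁ : FracturedRel 2
  | prec₂ : FracturedRel 2

/-- The language `{E, ≺₁, ≺₂}` of fractured orders. -/
def fracturedLanguage : FirstOrder.Language.{0, 0} := ⟨fun _ => Empty, FracturedRel⟩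

/-- The relation of a structure interpreting a binary symbol. -/
def binRel {L : FirstOrder.Language.{0, 0}} {M : Type} (S : L.Structure M) (R : L.Relations 2) (a b : M) :
    Prop :=
  S.RelMap R ![a, b]

/-- The axioms of fractured orders. Partial orders are strict, as for the symbol `<`. -/
structure IsFracturedOrder (M : Type) (S : fracturedLanguage.Structure M) : Prop where
  prec₁_order : IsStrictOrder M (binRel S FracturedRel.prec₁)
  prec₂_order : IsStrictOrder M (binRel S FracturedRel.prec₂)
  equiv_equivalence : Equivalence (binRel S FracturedRel.equiv)
  prec₁_comparable_iff : ∀ a b : M, a ≠ b →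
    ((binRel S FracturedRel.prec₁ a b ∨ binRel S FracturedRel.prec₁ b a) ↔
      ¬ binRel S FracturedRel.equiv a b)
  prec₂_comparable_iff : ∀ a b : M, a ≠ b →
    ((binRel S FracturedRel.prec₂ a b ∨ binRel S FracturedRel.prec₂ b a) ↔
      binRel S FracturedRel.equiv a b)
  convex : ∀ a a' b : M, binRel S FracturedRel.equiv a a' →
    binRel S FracturedRel.prec₁ a b → binRel S FracturedRel.prec₁ a' b

/-! ### Compositions -/

/-- The relation symbols `E`, `≺₁`, both binary. -/
inductive CompositionRel : ℕ → Type
  | equiv : CompositionRel 2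
  | prec₁ : CompositionRel 2

/-- The language `{E, ≺₁}` of compositions. -/
def compositionLanguage : FirstOrder.Language.{0, 0} := ⟨fun _ => Empty, CompositionRel⟩

/-- The inclusion of relation symbols. -/
def CompositionRel.toFractured : ∀ {n : ℕ}, CompositionRel n → FracturedRel n
  | _, .equiv => .equiv
  | _, .prec₁ => .prec₁

/-- The inclusion of the language of compositions into the language of fractured orders. -/
def compositionInclusion : compositionLanguage →ᴸ fracturedLanguage where
  onFunction := fun _ f => f
  onRelation := fun _ R => CompositionRel.toFractured R

/-- A composition is the reduct to `{E, ≺₁}` of a fractured order: an equivalence relation `E`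
together with a linear order on the `E`-classes. -/
def IsComposition (M : Type) (S : compositionLanguage.Structure M) : Prop :=
  ∃ F : fracturedLanguage.Structure M,
    IsFracturedOrder M F ∧ @FirstOrder.Language.LHom.reduct _ _ compositionInclusion M F = S

end LogicalLimitLaw

namespace LogicalLimitLaw

/-! ### Finite aperiodic monoids -/

section Monoid

variable {M : Type*} [Monoid M]

/-! A composition of `n + 1` points is, up to isomorphism, a choice of which of the `n` gaps between
consecutive points separate two classes. A uniform unlabeled composition is therefore a uniform
binary word of length `n` (`codeEquiv`), and the proportion in question is an average over words
(`unlabeledProbability_succ`).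

By an Ehrenfeucht–Fraïssé argument (`realize_iff_of_rankAligned`), a sentence depends only on the
rank-`k` type of the word, for a `k` exceeding its quantifier depth. Rank-`k` types form a finite
quotient of the free monoid on two letters (`rankType_append`), and it is aperiodic: long powers of
a word have the same type (`rankType_flatten_replicate`). Aperiodicity is what excludes oscillation
with the length. It makes the local group at an idempotent of the minimal ideal trivial, which
yields a word `u` such that `u ++ v ++ u` has the type of `u` for every `v`
(`exists_absorbing_word`).

A long random word almost surely contains `u` both near its start and near its end. What lies
between the two occurrences, including its length, is then irrelevant, so the averages form a Cauchy
sequence (`exists_tendsto_wordAverage`). -/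

theorem eq_of_mul_eq_of_aperiodic {N : ℕ} (hN : ∀ x : M, x ^ N = x ^ (N + 1)) {e p y : M}
    (hpy : p * y = e) (hpe : p * e = p) : p = e := by
  -- Since `p * e * y = e`, the element `e` can be padded by `p` on the left and `y` on the right.
  -- In `p = p * e` the extra factor `p` is then swallowed by `p ^ N`.
  have key : ∀ n : ℕ, p ^ n * e * y ^ n = e := by
    intro n
    induction n with
    | zero => simp
    | succ n ih =>
      calc p ^ (n + 1) * e * y ^ (n + 1) = p ^ n * ((p * e) * y) * y ^ n := by
            simp only [pow_succ p, pow_succ' y, mul_assoc]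
        _ = e := by rw [hpe, hpy, ih]
  calc p = p * (p ^ N * e * y ^ N) := by rw [key, hpe]
    _ = p ^ (N + 1) * e * y ^ N := by simp only [pow_succ' p, mul_assoc]
    _ = e := by rw [← hN, key]

/-- The product `z` of all elements has every element as a factor, so the idempotent `e = z ^ N`
lies in the minimal ideal. There `e * M * e` is a group, and aperiodicity makes it trivial:
factoring `z` through `x = e * v * e` writes `e` as `(e * a * e) * (x * (e * b * e))`, and
cancelling twice gives `x = e`. -/
theorem exists_mul_mul_eq_of_aperiodic [Finite M] {N : ℕ} (hN : ∀ x : M, x ^ N = x ^ (N + 1)) :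
    ∃ e : M, ∀ v : M, e * v * e = e := by
  classical
  have := Fintype.ofFinite M
  set z : M := (Finset.univ : Finset M).toList.prod with hz
  have hfac : ∀ s : M, ∃ a b, z = a * s * b := by
    intro s
    obtain ⟨l₁, l₂, h⟩ := List.mem_iff_append.1 (Finset.mem_toList.2 (Finset.mem_univ s))
    exact ⟨l₁.prod, l₂.prod, by rw [hz, h]; simp [mul_assoc]⟩
  have hadd : ∀ m : ℕ, z ^ (N + m) = z ^ N := by
    intro m
    induction m with
    | zero => rfl
    | succ m ih => rw [← add_assoc, pow_succ, ih, ← pow_succ, ← hN]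
  set e : M := z ^ N with he
  have hee : e * e = e := by rw [he, ← pow_add, hadd]
  have hze : e * z = e := by rw [he, ← pow_succ, ← hN]
  refine ⟨e, fun v => ?_⟩
  obtain ⟨a, b, hab⟩ := hfac (e * v * e)
  have hx1 : e * (e * v * e) = e * v * e := by rw [← mul_assoc, ← mul_assoc, hee]
  have hx2 : e * v * e * e = e * v * e := by rw [mul_assoc, hee]
  generalize e * v * e = x at *
  have h1 : e * a * e * (x * (e * b * e)) = e := by
    calc e * a * e * (x * (e * b * e)) = e * (a * (e * x * e) * b) * e := by
          simp only [mul_assoc]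
      _ = e := by rw [hx1, hx2, ← hab, hze, hee]
  have h2 : e * a * e = e :=
    eq_of_mul_eq_of_aperiodic hN h1 (by rw [mul_assoc, hee])
  have h3 : x * (e * b * e) = e := by
    rw [h2, ← mul_assoc, hx1] at h1
    exact h1
  exact eq_of_mul_eq_of_aperiodic hN h3 hx2

end Monoid

/-! ### Rank types of binary words -/

/-- The finite type in which the rank-`k` types of binary words take their values. -/
def RankType : ℕ → Type
  | 0 => Unit
  | k + 1 => RankType k × Set (RankType k × Bool × RankType k)

instance RankType.finite : ∀ k, Finite (RankType k)
  | 0 => inferInstanceAs (Finite Unit)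
  | k + 1 => by
    have := RankType.finite k
    exact inferInstanceAs (Finite (RankType k × Set (RankType k × Bool × RankType k)))

/-- The rank-`k` type of a binary word: the rank-`k + 1` type records the rank-`k` types of both
sides of each letter. -/
def rankType : (k : ℕ) → List Bool → RankType k
  | 0, _ => ()
  -- Keeping the lower type makes equality at rank `k + 1` imply equality at rank `k` by projection.
  | k + 1, x => (rankType k x,
      {t | ∃ a c b, x = a ++ c :: b ∧ t = (rankType k a, c, rankType k b)})

/-- Each letter of `x` is matched by a letter of `y`, up to rank-`k` types. -/
def RankForth (k : ℕ) (x y : List Bool) : Prop :=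
  ∀ a c b, x = a ++ c :: b →
    ∃ a' b', y = a' ++ c :: b' ∧ rankType k a = rankType k a' ∧ rankType k b = rankType k b'

theorem rankType_succ_eq_iff {k : ℕ} {x y : List Bool} :
    rankType (k + 1) x = rankType (k + 1) y ↔
      rankType k x = rankType k y ∧ RankForth k x y ∧ RankForth k y x := by
  have sub : ∀ x y : List Bool,
      ({t | ∃ a c b, x = a ++ c :: b ∧ t = (rankType k a, c, rankType k b)} ⊆
        {t | ∃ a c b, y = a ++ c :: b ∧ t = (rankType k a, c, rankType k b)}) ↔
      RankForth k x y := by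
    intro x y
    constructor
    · intro h a c b hx
      obtain ⟨a', c', b', hy, ht⟩ := h ⟨a, c, b, hx, rfl⟩
      simp only [Prod.mk.injEq] at ht
      obtain ⟨h1, rfl, h2⟩ := ht
      exact ⟨a', b', hy, h1, h2⟩
    · rintro h _ ⟨a, c, b, hx, rfl⟩
      obtain ⟨a', b', hy, h1, h2⟩ := h a c b hx
      exact ⟨a', c, b', hy, by rw [h1, h2]⟩
  rw [← sub, ← sub, ← Set.Subset.antisymm_iff]
  exact Prod.mk.injEq _ _ _ _ ▸ Iff.rfl

/-- A letter of a concatenation lies in one of the two factors. It is answered in the corresponding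
factor, and the untouched factor is glued back on by induction on the rank. -/
theorem rankType_append {k : ℕ} : ∀ {x x' y y' : List Bool}, rankType k x = rankType k x' →
    rankType k y = rankType k y' → rankType k (x ++ y) = rankType k (x' ++ y') := by
  induction k with
  | zero => intros; rfl
  | succ k ih =>
    have forth : ∀ x x' y y' : List Bool, rankType (k + 1) x = rankType (k + 1) x' →
        rankType (k + 1) y = rankType (k + 1) y' → RankForth k (x ++ y) (x' ++ y') := by
      intro x x' y y' hx hy a c b h
      rw [rankType_succ_eq_iff] at hx hy
      rcases List.append_eq_append_iff.1 h with ⟨t, ha, hy'⟩ | ⟨t, hx', hb⟩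
      · obtain ⟨a', b', e, h1, h2⟩ := hy.2.1 t c b hy'
        exact ⟨x' ++ a', b', by simp [e], by rw [ha]; exact ih hx.1 h1, h2⟩
      · cases t with
        | nil =>
          obtain ⟨a', b', e, h1, h2⟩ := hy.2.1 [] c b (by simpa using hb.symm)
          refine ⟨x' ++ a', b', by simp [e], ?_, h2⟩
          rw [show a = x ++ [] by simpa using hx'.symm]
          exact ih hx.1 h1
        | cons d t =>
          simp only [List.cons_append, List.cons.injEq] at hb
          obtain ⟨rfl, rfl⟩ := hb
          obtain ⟨a', b', e, h1, h2⟩ := hx.2.1 a c t hx'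
          exact ⟨a', b' ++ y', by simp [e], h1, ih h2 hy.1⟩
    intro x x' y y' hx hy
    exact rankType_succ_eq_iff.2
      ⟨ih (rankType_succ_eq_iff.1 hx).1 (rankType_succ_eq_iff.1 hy).1,
        forth _ _ _ _ hx hy, forth _ _ _ _ hx.symm hy.symm⟩

theorem flatten_replicate_eq_append_cons {x : List Bool} {n : ℕ} : ∀ {a b : List Bool} {c : Bool},
    (List.replicate n x).flatten = a ++ c :: b →
    ∃ i r a' b', n = i + 1 + r ∧ x = a' ++ c :: b' ∧ a = (List.replicate i x).flatten ++ a' ∧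
      b = b' ++ (List.replicate r x).flatten := by
  induction n with
  | zero => intro a b c h; simp at h
  | succ n ih =>
    intro a b c h
    rw [List.replicate_succ, List.flatten_cons] at h
    have right : ∀ t, a = x ++ t → (List.replicate n x).flatten = t ++ c :: b →
        ∃ i r a' b', n + 1 = i + 1 + r ∧ x = a' ++ c :: b' ∧
          a = (List.replicate i x).flatten ++ a' ∧ b = b' ++ (List.replicate r x).flatten := by
      rintro t rfl ht
      obtain ⟨i, r, a', b', hn, h1, rfl, h3⟩ := ih ht
      exact ⟨i + 1, r, a', b', by omega, h1, by simp [List.replicate_succ], h3⟩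
    rcases List.append_eq_append_iff.1 h with ⟨t, ha, ht⟩ | ⟨t, hx, hb⟩
    · exact right t ha ht
    · cases t with
      | nil => exact right [] (by simpa using hx.symm) (by simpa using hb.symm)
      | cons d t =>
        simp only [List.cons_append, List.cons.injEq] at hb
        obtain ⟨rfl, rfl⟩ := hb
        exact ⟨0, n, a, t, by omega, hx, by simp, rfl⟩

/-- The usual halving argument for long linear orders, with copies of `x` as points: one rank is
paid for splitting a power at one copy, so a threshold of `2 ^ k - 1` copies suffices at rank `k`.
-/
theorem rankType_flatten_replicate (x : List Bool) {k : ℕ} : ∀ {m n : ℕ}, 2 ^ k ≤ m + 1 →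
    2 ^ k ≤ n + 1 →
    rankType k (List.replicate m x).flatten = rankType k (List.replicate n x).flatten := by
  induction k with
  | zero => intros; rfl
  | succ k ih =>
    have forth : ∀ m n : ℕ, 2 ^ (k + 1) ≤ m + 1 → 2 ^ (k + 1) ≤ n + 1 →
        RankForth k (List.replicate m x).flatten (List.replicate n x).flatten := by
      intro m n hm hn a c b h
      obtain ⟨i, r, a', b', hm', hx, rfl, rfl⟩ := flatten_replicate_eq_append_cons h
      obtain ⟨j, s, hn', hj, hs⟩ : ∃ j s, n = j + 1 + s ∧
          (i = j ∨ (2 ^ k ≤ i + 1 ∧ 2 ^ k ≤ j + 1)) ∧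
          (r = s ∨ (2 ^ k ≤ r + 1 ∧ 2 ^ k ≤ s + 1)) := by
        rw [pow_succ] at hm hn
        have hk : 1 ≤ 2 ^ k := Nat.one_le_two_pow
        -- A short side is copied exactly. If both are long, `2 ^ k - 1` copies on the left leave `n
        -- - 2 ^ k ≥ 2 ^ k - 1` on the right.
        by_cases h1 : i + 1 < 2 ^ k
        · exact ⟨i, n - 1 - i, by omega, by omega, by omega⟩
        · by_cases h2 : r + 1 < 2 ^ k
          · exact ⟨n - 1 - r, r, by omega, by omega, by omega⟩
          · exact ⟨2 ^ k - 1, n - 2 ^ k, by omega, by omega, by omega⟩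
      have eqv : ∀ {i j : ℕ}, (i = j ∨ (2 ^ k ≤ i + 1 ∧ 2 ^ k ≤ j + 1)) →
          rankType k (List.replicate i x).flatten = rankType k (List.replicate j x).flatten := by
        rintro i j (rfl | ⟨h1, h2⟩)
        · rfl
        · exact ih h1 h2
      refine ⟨(List.replicate j x).flatten ++ a', b' ++ (List.replicate s x).flatten, ?_,
        rankType_append (eqv hj) rfl, rankType_append rfl (eqv hs)⟩
      rw [hn', List.replicate_add, List.replicate_add, List.flatten_append, List.flatten_append]
      nth_rw 2 [hx]
      simp
    intro m n hm hn
    have hle : 2 ^ k ≤ 2 ^ (k + 1) := Nat.pow_le_pow_right (by norm_num) (by omega)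
    exact rankType_succ_eq_iff.2 ⟨ih (hle.trans hm) (hle.trans hn), forth _ _ hm hn,
      forth _ _ hn hm⟩

/-- Equality of rank-`k` types as a congruence on the free monoid. -/
def rankCon (k : ℕ) : Con (FreeMonoid Bool) where
  r x y := rankType k x.toList = rankType k y.toList
  iseqv := ⟨fun _ => rfl, fun h => h.symm, fun h h' => h.trans h'⟩
  mul' := rankType_append

theorem toList_pow_eq (x : FreeMonoid Bool) (n : ℕ) :
    (x ^ n).toList = (List.replicate n x.toList).flatten := by
  induction n with
  | zero => rfl
  | succ n ih => rw [pow_succ', FreeMonoid.toList_mul, ih, List.replicate_succ, List.flatten_cons]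

theorem exists_absorbing_word (k : ℕ) :
    ∃ u : List Bool, ∀ v, rankType k (u ++ v ++ u) = rankType k u := by
  have : Finite (rankCon k).Quotient := by
    refine Finite.of_injective
      (Quotient.lift (fun x : FreeMonoid Bool => rankType k x.toList) fun _ _ h => h :
        (rankCon k).Quotient → RankType k) ?_
    rintro ⟨x⟩ ⟨y⟩ h
    exact Quotient.sound h
  obtain ⟨e, he⟩ := exists_mul_mul_eq_of_aperiodic (M := (rankCon k).Quotient) (N := 2 ^ k) (by
    intro x
    induction x using Con.induction_on with
    | H x =>
      have hpow : ∀ n : ℕ, (x : (rankCon k).Quotient) ^ n = ((x ^ n : FreeMonoid Bool) : _) :=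
        fun _ => rfl
      rw [hpow, hpow, Con.eq]
      change rankType k _ = rankType k _
      rw [toList_pow_eq, toList_pow_eq]
      exact rankType_flatten_replicate _ (by omega) (by omega))
  induction e using Con.induction_on with
  | H u =>
    refine ⟨u.toList, fun v => ?_⟩
    have := he ((FreeMonoid.ofList v : FreeMonoid Bool) : (rankCon k).Quotient)
    rw [← Con.coe_mul, ← Con.coe_mul, Con.eq] at this
    exact this

/-! ### Averages over binary words -/

/-- The average of `f` over the binary words of length `n`. -/
noncomputable def wordAverage : ℕ → (List Bool → ℝ) → ℝ
  | 0, f => f []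
  | n + 1, f => (wordAverage n (fun w => f (false :: w)) + wordAverage n (fun w => f (true :: w))) / 2

theorem wordAverage_mono {n : ℕ} : ∀ {f g : List Bool → ℝ}, (∀ w, w.length = n → f w ≤ g w) →
    wordAverage n f ≤ wordAverage n g := by
  induction n with
  | zero => intro f g h; exact h [] rfl
  | succ n ih =>
    intro f g h
    have h1 := ih (f := fun w => f (false :: w)) (g := fun w => g (false :: w))
      fun w hw => h _ (by simp [hw])
    have h2 := ih (f := fun w => f (true :: w)) (g := fun w => g (true :: w))
      fun w hw => h _ (by simp [hw])
    simp only [wordAverage]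
    linarith

theorem wordAverage_const (n : ℕ) (c : ℝ) : wordAverage n (fun _ => c) = c := by
  induction n with
  | zero => rfl
  | succ n ih => simp [wordAverage, ih]

theorem wordAverage_add {n : ℕ} : ∀ f g : List Bool → ℝ,
    wordAverage n (fun w => f w + g w) = wordAverage n f + wordAverage n g := by
  induction n with
  | zero => intro f g; rfl
  | succ n ih => intro f g; simp only [wordAverage, ih]; ring

theorem wordAverage_mul_left {n : ℕ} (c : ℝ) : ∀ f : List Bool → ℝ,
    wordAverage n (fun w => c * f w) = c * wordAverage n f := by
  induction n with
  | zero => intro f; rfl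
  | succ n ih => intro f; simp only [wordAverage, ih]; ring

theorem wordAverage_append {m n : ℕ} : ∀ f : List Bool → ℝ,
    wordAverage (m + n) f = wordAverage m fun x => wordAverage n fun y => f (x ++ y) := by
  induction m with
  | zero => intro f; simp [wordAverage]
  | succ m ih =>
    intro f
    rw [Nat.succ_add]
    simp only [wordAverage, ih, List.cons_append]

theorem wordAverage_eq_sum {n : ℕ} : ∀ f : List Bool → ℝ,
    wordAverage n f = (∑ b : Fin n → Bool, f (List.ofFn b)) / 2 ^ n := by
  induction n with
  | zero => intro f; simp [wordAverage]
  | succ n ih =>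
    intro f
    rw [← (Fin.consEquiv fun _ : Fin (n + 1) => Bool).sum_comp, Fintype.sum_prod_type]
    have hcons : ∀ (c : Bool) (b : Fin n → Bool),
        List.ofFn (Fin.consEquiv (fun _ : Fin (n + 1) => Bool) (c, b)) = c :: List.ofFn b :=
      fun c b => List.ofFn_cons c b
    simp only [wordAverage, ih, Fintype.sum_bool, hcons, pow_succ]
    field_simp
    ring

theorem wordAverage_ne_lt_one (u : List Bool) :
    wordAverage u.length (Set.indicator {w | w ≠ u} 1) < 1 := by
  induction u with
  | nil => simp [wordAverage]
  | cons c u ih =>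
    have hle : ∀ g : List Bool → List Bool,
        wordAverage u.length (fun w => Set.indicator {w | w ≠ c :: u} (1 : List Bool → ℝ) (g w)) ≤ 1 := by
      intro g
      refine (wordAverage_mono fun w _ => ?_).trans (wordAverage_const u.length 1).le
      exact Set.indicator_le_self' (by simp) _
    have heq : wordAverage u.length
        (fun w => Set.indicator {w | w ≠ c :: u} (1 : List Bool → ℝ) (c :: w)) < 1 := by
      refine lt_of_le_of_lt (wordAverage_mono fun w _ => ?_) ih
      by_cases h : w = u <;> simp [Set.indicator, h]
    simp only [List.length_cons, wordAverage]
    have h1 := hle (List.cons true)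
    have h2 := hle (List.cons false)
    cases c <;> linarith

/-- The indicator function of the words without the factor `u`. -/
noncomputable def avoiding (u : List Bool) : List Bool → ℝ :=
  Set.indicator {w | ¬ u <:+: w} 1

theorem avoiding_nonneg (u w : List Bool) : 0 ≤ avoiding u w :=
  Set.indicator_nonneg (by simp) _

/-- Cut the word into blocks of length `u.length`. Avoiding `u` forces every block to differ from
`u`, so the average over `j` blocks is at most `q ^ j` with `q < 1`. -/
theorem exists_wordAverage_avoiding_lt (u : List Bool) {ε : ℝ} (hε : 0 < ε) :
    ∃ m, wordAverage m (avoiding u) < ε := by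
  set q := wordAverage u.length (Set.indicator {w | w ≠ u} 1) with hq
  have hq0 : 0 ≤ q := by
    rw [← wordAverage_const u.length 0]
    exact wordAverage_mono fun w _ => Set.indicator_nonneg (by simp) _
  have key : ∀ j : ℕ, wordAverage (j * u.length) (avoiding u) ≤ q ^ j := by
    intro j
    induction j with
    | zero =>
      rw [pow_zero, ← wordAverage_const (0 * u.length) 1]
      exact wordAverage_mono fun w _ => Set.indicator_le_self' (by simp) _
    | succ j ih =>
      rw [Nat.succ_mul, wordAverage_append, pow_succ']
      refine le_trans ?_ (mul_le_mul_of_nonneg_left ih hq0)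
      rw [← wordAverage_mul_left]
      refine wordAverage_mono fun x _ => ?_
      rw [mul_comm, hq, ← wordAverage_mul_left]
      refine wordAverage_mono fun y _ => ?_
      by_cases h1 : u <:+: x
      · have : u <:+: x ++ y := h1.trans (List.prefix_append x y).isInfix
        simp [avoiding, Set.indicator, h1, this]
      · by_cases h2 : y = u
        · have : u <:+: x ++ u := (List.suffix_append x u).isInfix
          simp [avoiding, Set.indicator, this, h1, h2]
        · by_cases h3 : u <:+: x ++ y <;> simp [avoiding, Set.indicator, h1, h2, h3]
  obtain ⟨j, hj⟩ := exists_pow_lt_of_lt_one hε (wordAverage_ne_lt_one u)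
  exact ⟨_, (key j).trans_lt hj⟩

/-- Compare words `x ++ y ++ z` of length `n` with `x ++ z` of length `2 * m`, sharing the same
random `x` and `z`. If both contain `u`, membership in `Q` agrees, as everything between the two
occurrences can be erased. The exceptional cases contribute less than `ε / 2 + ε / 2`. -/
theorem exists_tendsto_wordAverage {Q : Set (List Bool)} {u : List Bool}
    (hQ : ∀ a v c, a ++ u ++ v ++ u ++ c ∈ Q ↔ a ++ u ++ c ∈ Q) :
    ∃ p : ℝ, Tendsto (fun n => wordAverage n (Q.indicator 1)) atTop (𝓝 p) := by
  refine cauchySeq_tendsto_of_complete (Metric.cauchySeq_iff'.2 fun ε hε => ?_)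
  obtain ⟨m, hm⟩ := exists_wordAverage_avoiding_lt u (half_pos hε)
  refine ⟨m + m, fun n hn => ?_⟩
  obtain ⟨r, rfl⟩ : ∃ r, n = m + (r + m) := ⟨n - 2 * m, by omega⟩
  have hpt : ∀ x y z : List Bool, Q.indicator (1 : List Bool → ℝ) (x ++ (y ++ z)) ≤
      Q.indicator 1 (x ++ z) + (avoiding u x + avoiding u z) ∧
      Q.indicator (1 : List Bool → ℝ) (x ++ z) ≤
      Q.indicator 1 (x ++ (y ++ z)) + (avoiding u x + avoiding u z) := by
    intro x y z
    have h0 : ∀ w, 0 ≤ Q.indicator (1 : List Bool → ℝ) w := fun w =>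
      Set.indicator_nonneg (by simp) _
    have h1 : ∀ w, Q.indicator (1 : List Bool → ℝ) w ≤ 1 := fun w =>
      Set.indicator_le_self' (by simp) _
    have hx := avoiding_nonneg u x
    have hz := avoiding_nonneg u z
    have := h0 (x ++ z)
    have := h1 (x ++ z)
    have := h0 (x ++ (y ++ z))
    have := h1 (x ++ (y ++ z))
    by_cases hxu : u <:+: x
    · by_cases hzu : u <:+: z
      · obtain ⟨a, b, rfl⟩ := hxu
        obtain ⟨b', c, rfl⟩ := hzu
        have e1 := hQ a (b ++ y ++ b') c
        have e2 := hQ a (b ++ b') c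
        have e : a ++ u ++ b ++ (y ++ (b' ++ u ++ c)) ∈ Q ↔
            a ++ u ++ b ++ (b' ++ u ++ c) ∈ Q := by
          simp only [List.append_assoc] at e1 e2 ⊢
          exact e1.trans e2.symm
        have : Q.indicator (1 : List Bool → ℝ) (a ++ u ++ b ++ (y ++ (b' ++ u ++ c))) =
            Q.indicator 1 (a ++ u ++ b ++ (b' ++ u ++ c)) := by
          classical
          simp only [Set.indicator, e]
          simp
        constructor <;> linarith
      · have : avoiding u z = 1 := by simp [avoiding, hzu]
        constructor <;> linarith
    · have : avoiding u x = 1 := by simp [avoiding, hxu]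
      constructor <;> linarith
  have h1 := wordAverage_mono (n := m) fun x _ => wordAverage_mono (n := r) fun y _ =>
    wordAverage_mono (n := m) fun z _ => (hpt x y z).1
  have h2 := wordAverage_mono (n := m) fun x _ => wordAverage_mono (n := r) fun y _ =>
    wordAverage_mono (n := m) fun z _ => (hpt x y z).2
  simp only [wordAverage_add, wordAverage_const] at h1 h2
  simp only [Real.dist_eq, wordAverage_append]
  rw [abs_lt]
  constructor <;> linarith

/-! ### Positions of the Ehrenfeucht–Fraïssé game on words -/

/-- `Aligned r x y p`: the pairs of positions in `p` cut the words `x` and `y` into equally many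
pieces, the letters at paired positions agree and corresponding pieces are related by `r`. -/
inductive Aligned (r : List Bool → List Bool → Prop) :
    List Bool → List Bool → Set (ℕ × ℕ) → Prop
  | leaf {x y : List Bool} : r x y → Aligned r x y ∅
  | node {x y x' y' : List Bool} {p q : Set (ℕ × ℕ)} (c : Bool) :
      Aligned r x y p → Aligned r x' y' q →
      Aligned r (x ++ c :: x') (y ++ c :: y')
        (p ∪ insert (x.length, y.length)
          ((fun z : ℕ × ℕ => (x.length + 1 + z.1, y.length + 1 + z.2)) '' q))

theorem Aligned.mono {r s : List Bool → List Bool → Prop} (hrs : ∀ x y, r x y → s x y)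
    {x y : List Bool} {p : Set (ℕ × ℕ)} (h : Aligned r x y p) : Aligned s x y p := by
  induction h with
  | leaf h => exact .leaf (hrs _ _ h)
  | node c _ _ ih ih' => exact .node c ih ih'

theorem Aligned.swap {r : List Bool → List Bool → Prop} {x y : List Bool} {p : Set (ℕ × ℕ)}
    (h : Aligned r x y p) : Aligned (fun a b => r b a) y x (Prod.swap ⁻¹' p) := by
  induction h with
  | leaf h => exact .leaf h
  | node c _ _ ih ih' =>
    convert Aligned.node c ih ih' using 1
    ext ⟨i, j⟩
    simp only [Set.mem_preimage, Set.mem_union, Set.mem_insert_iff, Set.mem_image, Prod.exists,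
      Prod.swap_prod_mk, Prod.mk.injEq]
    constructor
    · rintro (h | ⟨h1, h2⟩ | ⟨a, b, h, h1, h2⟩)
      · exact Or.inl h
      · exact Or.inr (Or.inl ⟨h2, h1⟩)
      · exact Or.inr (Or.inr ⟨b, a, h, h2, h1⟩)
    · rintro (h | ⟨h1, h2⟩ | ⟨a, b, h, h1, h2⟩)
      · exact Or.inl h
      · exact Or.inr (Or.inl ⟨h2, h1⟩)
      · exact Or.inr (Or.inr ⟨b, a, h, h2, h1⟩)

/-- One round of the game: the chosen position is already paired or splits a single piece, which is
answered by `hr`. All other pieces only weaken from `r` to `s`. -/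
theorem Aligned.forth {r s : List Bool → List Bool → Prop} (hrs : ∀ x y, r x y → s x y)
    (hr : ∀ x y, r x y → ∀ a c b, x = a ++ c :: b → ∃ a' b', y = a' ++ c :: b' ∧ s a a' ∧ s b b')
    {x y : List Bool} {p : Set (ℕ × ℕ)} (h : Aligned r x y p) :
    ∀ i < x.length, ∃ j q, p ⊆ q ∧ (i, j) ∈ q ∧ Aligned s x y q := by
  induction h with
  | @leaf x y h =>
    intro i hi
    have hx : x = x.take i ++ x[i] :: x.drop (i + 1) := by simp
    obtain ⟨a, b, rfl, ha, hb⟩ := hr _ _ h _ _ _ hx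
    have hn := Aligned.node x[i] (Aligned.leaf ha) (Aligned.leaf hb)
    rw [← hx] at hn
    exact ⟨_, _, Set.empty_subset _, Or.inr (Set.mem_insert_iff.2 (Or.inl (by
      rw [List.length_take_of_le hi.le]))), hn⟩
  | @node x y x' y' p q c h h' ih ih' =>
    intro i hi
    rcases lt_trichotomy i x.length with hlt | rfl | hlt
    · obtain ⟨j, p', hp, hj, ha⟩ := ih i hlt
      exact ⟨j, _, Set.union_subset_union_left _ hp, Or.inl hj, .node c ha (h'.mono hrs)⟩
    · exact ⟨y.length, _, subset_rfl, Or.inr (Set.mem_insert _ _),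
        .node c (h.mono hrs) (h'.mono hrs)⟩
    · obtain ⟨k, rfl⟩ : ∃ k, i = x.length + 1 + k := ⟨i - (x.length + 1), by omega⟩
      obtain ⟨j, q', hq, hj, ha⟩ := ih' k (by simp at hi; omega)
      exact ⟨y.length + 1 + j, _,
        Set.union_subset_union_right _ (Set.insert_subset_insert (Set.image_mono hq)),
        Or.inr (Or.inr ⟨(k, j), hj, rfl⟩), .node c (h.mono hrs) ha⟩

theorem Aligned.lt_length {r : List Bool → List Bool → Prop} {x y : List Bool} {p : Set (ℕ × ℕ)}
    (h : Aligned r x y p) : ∀ z ∈ p, z.1 < x.length ∧ z.2 < y.length := by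
  induction h with
  | leaf h => simp
  | node c _ _ ih ih' =>
    rintro z (hz | rfl | ⟨w, hw, rfl⟩)
    · have := ih _ hz
      simp only [List.length_append, List.length_cons]
      omega
    · simp
    · have := ih' _ hw
      simp only [List.length_append, List.length_cons]
      omega

theorem Aligned.lt_iff_lt {r : List Bool → List Bool → Prop} {x y : List Bool} {p : Set (ℕ × ℕ)}
    (h : Aligned r x y p) : ∀ z ∈ p, ∀ w ∈ p, (z.1 < w.1 ↔ z.2 < w.2) := by
  induction h with
  | leaf h => simp
  | node c h h' ih ih' =>
    rintro z (hz | rfl | ⟨z, hz, rfl⟩) w (hw | rfl | ⟨w, hw, rfl⟩)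
    · exact ih _ hz _ hw
    · have := h.lt_length _ hz
      simp [this]
    · have := h.lt_length _ hz
      simp only
      omega
    · have := h.lt_length _ hw
      simp only
      omega
    · simp
    · simp only
      omega
    · have := h.lt_length _ hw
      simp only
      omega
    · simp only
      omega
    · have := ih' _ hz _ hw
      simp only
      omega

theorem Aligned.getElem?_eq {r : List Bool → List Bool → Prop} {x y : List Bool}
    {p : Set (ℕ × ℕ)} (h : Aligned r x y p) : ∀ z ∈ p, x[z.1]? = y[z.2]? := by
  induction h with
  | leaf h => simp
  | node c h h' ih ih' =>
    rintro z (hz | rfl | ⟨z, hz, rfl⟩)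
    · have := h.lt_length _ hz
      rw [List.getElem?_append_left this.1, List.getElem?_append_left this.2, ih _ hz]
    · simp
    · have e : ∀ (a b : List Bool) (k : ℕ), (a ++ c :: b)[a.length + 1 + k]? = b[k]? := by
        intro a b k
        rw [List.getElem?_append_right (by omega),
          show a.length + 1 + k - a.length = k + 1 by omega, List.getElem?_cons_succ]
      simp only [e]
      exact ih' _ hz

/-- Positions aligned up to rank-`k` types. -/
abbrev RankAligned (k : ℕ) : List Bool → List Bool → Set (ℕ × ℕ) → Prop :=
  Aligned fun x y => rankType k x = rankType k y

theorem RankAligned.swap {k : ℕ} {x y : List Bool} {p : Set (ℕ × ℕ)} (h : RankAligned k x y p) :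
    RankAligned k y x (Prod.swap ⁻¹' p) :=
  (Aligned.swap h).mono fun _ _ => Eq.symm

theorem RankAligned.forth {k : ℕ} {x y : List Bool} {p : Set (ℕ × ℕ)}
    (h : RankAligned (k + 1) x y p) :
    ∀ i < x.length, ∃ j q, p ⊆ q ∧ (i, j) ∈ q ∧ RankAligned k x y q :=
  Aligned.forth (fun _ _ h => (rankType_succ_eq_iff.1 h).1)
    (fun _ _ h => (rankType_succ_eq_iff.1 h).2.1) h

theorem RankAligned.mono {k l : ℕ} (hkl : k ≤ l) {x y : List Bool} {p : Set (ℕ × ℕ)}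
    (h : RankAligned l x y p) : RankAligned k x y p := by
  induction hkl with
  | refl => exact h
  | step _ ih => exact ih (Aligned.mono (fun _ _ h => (rankType_succ_eq_iff.1 h).1) h)

/-! ### Compositions coded by sets of cuts -/

/-- The fractured order on `Fin n` whose `E`-classes are the intervals between cuts, where `cut m`
means that there is a cut between `m` and `m + 1`. -/
@[reducible] def cutFractured (n : ℕ) (cut : ℕ → Prop) : fracturedLanguage.Structure (Fin n) where
  funMap f := f.elim
  RelMap {k} R v := match k, R, v with
    | _, .equiv, v => (¬ ∃ m, (v 0).1 ≤ m ∧ m < (v 1).1 ∧ cut m) ∧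
        ¬ ∃ m, (v 1).1 ≤ m ∧ m < (v 0).1 ∧ cut m
    | _, .prec₁, v => ∃ m, (v 0).1 ≤ m ∧ m < (v 1).1 ∧ cut m
    | _, .prec₂, v => v 0 < v 1 ∧ ¬ ∃ m, (v 0).1 ≤ m ∧ m < (v 1).1 ∧ cut m

/-- The composition on `Fin n` given by a set of cuts. -/
@[reducible] def cutComposition (n : ℕ) (cut : ℕ → Prop) : compositionLanguage.Structure (Fin n) :=
  @FirstOrder.Language.LHom.reduct _ _ compositionInclusion _ (cutFractured n cut)

/-- There is a cut between `i` and `j`. -/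
def Separated (cut : ℕ → Prop) (i j : ℕ) : Prop :=
  ∃ m, i ≤ m ∧ m < j ∧ cut m

/-- The set of cuts coded by a binary word. -/
def wordCut (x : List Bool) (m : ℕ) : Prop :=
  x[m]? = some true

/-- Being separated quantifies over a cut position, so transferring it costs one round. This is why
rank `quantifierDepth φ + 1` is used for sentences. -/
theorem RankAligned.separated {x y : List Bool} {p : Set (ℕ × ℕ)} (h : RankAligned 1 x y p)
    {i j i' j' : ℕ} (hi : (i, i') ∈ p) (hj : (j, j') ∈ p) (hs : Separated (wordCut x) i j) :
    Separated (wordCut y) i' j' := by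
  obtain ⟨m, him, hmj, hm⟩ := hs
  have hlt := (h.lt_length _ hj).1
  obtain ⟨m', q, hpq, hmq, hq⟩ := h.forth m (hmj.trans hlt)
  refine ⟨m', not_lt.1 fun hlt => ?_, (hq.lt_iff_lt _ hmq _ (hpq hj)).1 hmj, ?_⟩
  · exact not_lt.2 him ((hq.lt_iff_lt _ hmq _ (hpq hi)).2 hlt)
  · exact (hq.getElem?_eq _ hmq).symm.trans hm

theorem RankAligned.separated_iff {x y : List Bool} {p : Set (ℕ × ℕ)} (h : RankAligned 1 x y p)
    {i j i' j' : ℕ} (hi : (i, i') ∈ p) (hj : (j, j') ∈ p) :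
    Separated (wordCut x) i j ↔ Separated (wordCut y) i' j' :=
  ⟨h.separated hi hj, h.swap.separated hi hj⟩

/-- The quantifier depth of a formula. -/
def quantifierDepth {L : FirstOrder.Language.{0, 0}} {α : Type} :
    ∀ {n : ℕ}, L.BoundedFormula α n → ℕ
  | _, .falsum => 0
  | _, .equal _ _ => 0
  | _, .rel _ _ => 0
  | _, .imp φ ψ => max (quantifierDepth φ) (quantifierDepth ψ)
  | _, .all φ => quantifierDepth φ + 1

/-- The variable that a term of the relational language of compositions consists of. -/
theorem exists_eq_var {n : ℕ} (t : compositionLanguage.Term (Empty ⊕ Fin n)) :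
    ∃ i, t = .var (.inr i) := by
  match t with
  | .var (.inr i) => exact ⟨i, rfl⟩
  | .func f _ => exact f.elim

theorem realize_iff_of_rankAligned {n : ℕ} (φ : compositionLanguage.BoundedFormula Empty n) :
    ∀ {x y : List Bool} {p : Set (ℕ × ℕ)}, RankAligned (quantifierDepth φ + 1) x y p →
      ∀ {v : Fin n → Fin x.length} {w : Fin n → Fin y.length},
      (∀ i, ((v i : ℕ), (w i : ℕ)) ∈ p) →
      (@FirstOrder.Language.BoundedFormula.Realize _ _ (cutComposition x.length (wordCut x)) _ _ φ
          default v ↔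
        @FirstOrder.Language.BoundedFormula.Realize _ _ (cutComposition y.length (wordCut y)) _ _ φ
          default w) := by
  induction φ with
  | falsum => intros; exact Iff.rfl
  | equal t₁ t₂ =>
    intro x y p h v w hvw
    obtain ⟨i, rfl⟩ := exists_eq_var t₁
    obtain ⟨j, rfl⟩ := exists_eq_var t₂
    change v i = v j ↔ w i = w j
    have h1 := h.lt_iff_lt _ (hvw i) _ (hvw j)
    have h2 := h.lt_iff_lt _ (hvw j) _ (hvw i)
    simp only at h1 h2
    rw [Fin.ext_iff, Fin.ext_iff]
    omega
  | rel R ts =>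
    intro x y p h v w hvw
    choose f hf using fun i => exists_eq_var (ts i)
    obtain rfl : ts = fun i => .var (.inr (f i)) := funext hf
    cases R with
    | equiv =>
      exact and_congr (not_congr (h.separated_iff (hvw _) (hvw _)))
        (not_congr (h.separated_iff (hvw _) (hvw _)))
    | prec₁ => exact h.separated_iff (hvw _) (hvw _)
  | imp φ ψ ih ih' =>
    intro x y p h v w hvw
    exact imp_congr
      (ih (h.mono (by simp only [quantifierDepth]; omega)) hvw)
      (ih' (h.mono (by simp only [quantifierDepth]; omega)) hvw)
  | all φ ih =>
    have forth : ∀ {x y : List Bool} {p : Set (ℕ × ℕ)}, RankAligned (quantifierDepth φ + 2) x y p →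
        ∀ {v : Fin _ → Fin x.length} {w : Fin _ → Fin y.length},
        (∀ i, ((v i : ℕ), (w i : ℕ)) ∈ p) →
        (∀ b, @FirstOrder.Language.BoundedFormula.Realize _ _ (cutComposition y.length (wordCut y))
          _ _ φ default (Fin.snoc w b)) →
        ∀ a, @FirstOrder.Language.BoundedFormula.Realize _ _ (cutComposition x.length (wordCut x))
          _ _ φ default (Fin.snoc v a) := by
      intro x y p h v w hvw H a
      obtain ⟨b, q, hpq, hab, hq⟩ := h.forth a a.2
      refine (ih hq (w := Fin.snoc w ⟨b, (hq.lt_length _ hab).2⟩) fun i => ?_).2 (H _)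
      refine Fin.lastCases ?_ (fun i => ?_) i
      · simpa using hab
      · simpa using hpq (hvw i)
    intro x y p h v w hvw
    -- `forth` carries the universal statement from the second word to the first; swapping gives the
    -- other direction.
    exact ⟨forth h.swap hvw, forth h hvw⟩

/-- The words whose compositions satisfy `φ`. -/
def wordModels (φ : compositionLanguage.Sentence) : Set (List Bool) :=
  {x | @FirstOrder.Language.Sentence.Realize _ _ (cutComposition x.length (wordCut x)) φ}

theorem mem_wordModels_iff_of_rankType_eq {φ : compositionLanguage.Sentence} {x y : List Bool}
    (h : rankType (quantifierDepth φ + 1) x = rankType (quantifierDepth φ + 1) y) :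
    x ∈ wordModels φ ↔ y ∈ wordModels φ :=
  realize_iff_of_rankAligned φ (.leaf h) fun i => i.elim0

theorem exists_tendsto_wordAverage_wordModels (φ : compositionLanguage.Sentence) (s : List Bool) :
    ∃ p : ℝ, Tendsto (fun n => wordAverage n ({w | w ++ s ∈ wordModels φ}.indicator 1)) atTop
      (𝓝 p) := by
  obtain ⟨u, hu⟩ := exists_absorbing_word (quantifierDepth φ + 1)
  refine exists_tendsto_wordAverage (u := u) fun a v c => ?_
  refine mem_wordModels_iff_of_rankType_eq (rankType_append (rankType_append ?_ rfl) rfl)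
  have := rankType_append (rfl : rankType _ a = rankType _ a) (hu v)
  simpa only [List.append_assoc] using this

/-! ### Compositions up to isomorphism -/

theorem isFracturedOrder_cutFractured (n : ℕ) (cut : ℕ → Prop) :
    IsFracturedOrder (Fin n) (cutFractured n cut) := by
  have lt_of_sep : ∀ {i j : ℕ}, Separated cut i j → i < j := fun ⟨m, h1, h2, _⟩ => h1.trans_lt h2
  have mono : ∀ {i j i' j' : ℕ}, i' ≤ i → j ≤ j' → Separated cut i j → Separated cut i' j' :=
    fun hi hj ⟨m, h1, h2, h3⟩ => ⟨m, hi.trans h1, h2.trans_le hj, h3⟩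
  have split : ∀ {i j : ℕ} (k : ℕ), Separated cut i j → Separated cut i k ∨ Separated cut k j :=
    fun k ⟨m, h1, h2, h3⟩ => (lt_or_ge m k).imp (fun h => ⟨m, h1, h, h3⟩) fun h => ⟨m, h, h2, h3⟩
  have e1 : ∀ a b : Fin n, binRel (cutFractured n cut) FracturedRel.prec₁ a b ↔
      Separated cut a b := fun _ _ => Iff.rfl
  have e2 : ∀ a b : Fin n, binRel (cutFractured n cut) FracturedRel.prec₂ a b ↔
      a < b ∧ ¬ Separated cut a b := fun _ _ => Iff.rfl
  have e3 : ∀ a b : Fin n, binRel (cutFractured n cut) FracturedRel.equiv a b ↔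
      ¬ Separated cut a b ∧ ¬ Separated cut b a := fun _ _ => Iff.rfl
  refine ⟨{ irrefl := fun a h => ?_, trans := fun a b c h h' => ?_ },
    { irrefl := fun a h => ?_, trans := fun a b c h h' => ?_ },
    ⟨fun a => ?_, fun h => ?_, fun {a b c} h h' => ?_⟩, fun a b hab => ?_, fun a b hab => ?_,
    fun a a' b h h' => ?_⟩
  · exact lt_irrefl _ (lt_of_sep h)
  · exact mono le_rfl (lt_of_sep h').le h
  · exact lt_irrefl _ h.1
  · rw [e2] at *
    exact ⟨h.1.trans h'.1, fun hs => (split (b : ℕ) hs).elim h.2 h'.2⟩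
  · exact ⟨fun h => lt_irrefl _ (lt_of_sep h), fun h => lt_irrefl _ (lt_of_sep h)⟩
  · exact h.symm
  · rw [e3] at *
    exact ⟨fun hs => (split (b : ℕ) hs).elim h.1 h'.1, fun hs => (split (b : ℕ) hs).elim h'.2 h.2⟩
  · rw [e1, e1, e3]
    tauto
  · rw [e2, e2, e3]
    have h1 : ¬ a < b → ¬ Separated cut a b := fun h h' => h (lt_of_sep h')
    have h2 : ¬ b < a → ¬ Separated cut b a := fun h h' => h (lt_of_sep h')
    rcases lt_or_gt_of_ne hab with h | h <;> have := h.asymm <;> tauto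
  · rw [e3] at h
    rw [e1] at h' ⊢
    exact (split (a' : ℕ) h').resolve_left h.1

theorem isComposition_cutComposition (n : ℕ) (cut : ℕ → Prop) :
    IsComposition (Fin n) (cutComposition n cut) :=
  ⟨cutFractured n cut, isFracturedOrder_cutFractured n cut, rfl⟩

theorem IsFracturedOrder.equiv_iff {M : Type} {F : fracturedLanguage.Structure M}
    (h : IsFracturedOrder M F) (a b : M) :
    binRel F FracturedRel.equiv a b ↔
      ¬ binRel F FracturedRel.prec₁ a b ∧ ¬ binRel F FracturedRel.prec₁ b a := by
  by_cases hab : a = b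
  · subst hab
    exact iff_of_true (h.equiv_equivalence.refl a) ⟨h.prec₁_order.irrefl a, h.prec₁_order.irrefl a⟩
  · have := h.prec₁_comparable_iff a b hab
    tauto

theorem IsComposition.equiv_iff {M : Type} {S : compositionLanguage.Structure M}
    (h : IsComposition M S) (a b : M) :
    binRel S CompositionRel.equiv a b ↔
      ¬ binRel S CompositionRel.prec₁ a b ∧ ¬ binRel S CompositionRel.prec₁ b a := by
  obtain ⟨F, hF, rfl⟩ := h
  exact hF.equiv_iff a b

/-- Compositions are determined up to isomorphism by the order of the classes. -/
theorem IsComposition.nonempty_equiv {M N : Type} {S : compositionLanguage.Structure M}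
    {T : compositionLanguage.Structure N} (hS : IsComposition M S) (hT : IsComposition N T)
    (e : M ≃ N) (he : ∀ a b, binRel S CompositionRel.prec₁ a b ↔
      binRel T CompositionRel.prec₁ (e a) (e b)) :
    Nonempty (@FirstOrder.Language.Equiv compositionLanguage M N S T) := by
  refine ⟨@FirstOrder.Language.Equiv.mk _ _ _ S T e (fun f => f.elim) fun {k} R v => ?_⟩
  have hS2 : ∀ (v : Fin 2 → M) (R : CompositionRel 2), S.RelMap R v ↔ binRel S R (v 0) (v 1) := by
    intro v R
    change S.RelMap R v ↔ S.RelMap R ![v 0, v 1]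
    rw [show ![v 0, v 1] = v from by ext i; fin_cases i <;> rfl]
  have hT2 : ∀ (v : Fin 2 → N) (R : CompositionRel 2), T.RelMap R v ↔ binRel T R (v 0) (v 1) := by
    intro v R
    change T.RelMap R v ↔ T.RelMap R ![v 0, v 1]
    rw [show ![v 0, v 1] = v from by ext i; fin_cases i <;> rfl]
  cases R with
  | equiv =>
    refine (hT2 _ _).trans (Iff.trans ?_ (hS2 _ _).symm)
    rw [hS.equiv_iff, hT.equiv_iff, he, he]
    rfl
  | prec₁ => exact (hT2 _ _).trans ((he _ _).symm.trans (hS2 _ _).symm)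

theorem exists_equiv_fin_of_isStrictTotalOrder {M : Type} [Fintype M] (r : M → M → Prop)
    [IsStrictTotalOrder M r] {n : ℕ} (hn : Fintype.card M = n) :
    ∃ e : M ≃ Fin n, ∀ a b, r a b ↔ e a < e b := by
  classical
  let _ := linearOrderOfSTO r
  let e := (Fintype.orderIsoFinOfCardEq M hn).symm
  exact ⟨e.toEquiv, fun a b => (e.lt_iff_lt (x := a) (y := b)).symm⟩

/-- Ordering the classes by `≺₁` and each class by `≺₂` is a lexicographic order. It lists the
points so that the classes become intervals. -/
theorem IsFracturedOrder.isStrictTotalOrder {M : Type} {F : fracturedLanguage.Structure M}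
    (h : IsFracturedOrder M F) :
    IsStrictTotalOrder M
      (fun a b => binRel F FracturedRel.prec₁ a b ∨ binRel F FracturedRel.prec₂ a b) := by
  have asymm : ∀ {a b}, binRel F FracturedRel.prec₁ a b → ¬ binRel F FracturedRel.prec₁ b a :=
    fun h1 h2 => h.prec₁_order.irrefl _ (h.prec₁_order.trans _ _ _ h1 h2)
  have toEquiv : ∀ {a b}, binRel F FracturedRel.prec₂ a b → binRel F FracturedRel.equiv a b := by
    intro a b hab
    refine (h.prec₂_comparable_iff a b ?_).1 (Or.inl hab)
    rintro rfl
    exact h.prec₂_order.irrefl _ hab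
  have right : ∀ {a b c}, binRel F FracturedRel.prec₁ a b → binRel F FracturedRel.equiv b c →
      binRel F FracturedRel.prec₁ a c := by
    intro a b c hab hbc
    by_contra hac
    by_cases hca : binRel F FracturedRel.prec₁ c a
    · exact asymm hab (h.convex c b a (h.equiv_equivalence.symm hbc) hca)
    · have := h.equiv_equivalence.trans ((h.equiv_iff a c).2 ⟨hac, hca⟩)
        (h.equiv_equivalence.symm hbc)
      exact ((h.equiv_iff a b).1 this).1 hab
  exact
    { irrefl := fun a ha => ha.elim (h.prec₁_order.irrefl a) (h.prec₂_order.irrefl a)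
      trans := by
        rintro a b c (h1 | h1) (h2 | h2)
        · exact Or.inl (h.prec₁_order.trans _ _ _ h1 h2)
        · exact Or.inl (right h1 (toEquiv h2))
        · exact Or.inl (h.convex b a c (h.equiv_equivalence.symm (toEquiv h1)) h2)
        · exact Or.inr (h.prec₂_order.trans _ _ _ h1 h2)
      trichotomous := by
        intro a b h1 h2
        by_contra hab
        have e1 := h.prec₁_comparable_iff a b hab
        have e2 := h.prec₂_comparable_iff a b hab
        tauto }

/-- Along that listing, put a cut after `m` when the `m`-th point is `≺₁` its successor. The set of
points `≺₁`-above a given point is upward closed, so it can only be entered across a cut. -/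
theorem IsComposition.exists_equiv_cutComposition {M : Type} [Fintype M] {n : ℕ}
    (hn : Fintype.card M = n) {S : compositionLanguage.Structure M} (hS : IsComposition M S) :
    ∃ (cut : ℕ → Prop) (e : M ≃ Fin n), ∀ a b, binRel S CompositionRel.prec₁ a b ↔
      Separated cut (e a) (e b) := by
  obtain ⟨F, hF, rfl⟩ := hS
  have := hF.isStrictTotalOrder
  obtain ⟨e, he⟩ := exists_equiv_fin_of_isStrictTotalOrder
    (fun a b => binRel F FracturedRel.prec₁ a b ∨ binRel F FracturedRel.prec₂ a b) hn
  have lt_of_prec : ∀ {a b}, binRel F FracturedRel.prec₁ a b → e a < e b :=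
    fun h => (he _ _).1 (Or.inl h)
  have asymm : ∀ {a b}, e a ≤ e b → ¬ binRel F FracturedRel.prec₁ b a :=
    fun h h' => not_lt.2 h (lt_of_prec h')
  have left : ∀ {a b c}, e a ≤ e b → binRel F FracturedRel.prec₁ b c →
      binRel F FracturedRel.prec₁ a c := by
    intro a b c hab hbc
    by_cases h : binRel F FracturedRel.prec₁ a b
    · exact hF.prec₁_order.trans _ _ _ h hbc
    · exact hF.convex b a c ((hF.equiv_iff b a).2 ⟨asymm hab, h⟩) hbc
  have right : ∀ {a b c}, binRel F FracturedRel.prec₁ a b → e b ≤ e c →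
      binRel F FracturedRel.prec₁ a c := by
    intro a b c hab hbc
    by_contra hac
    have hca : ¬ binRel F FracturedRel.prec₁ c a := asymm ((lt_of_prec hab).le.trans hbc)
    exact asymm hbc (hF.convex a c b ((hF.equiv_iff a c).2 ⟨hac, hca⟩) hab)
  refine ⟨fun m => ∃ a b, (e a : ℕ) = m ∧ (e b : ℕ) = m + 1 ∧ binRel F FracturedRel.prec₁ a b, e,
    fun a b => ⟨fun hab => ?_, ?_⟩⟩
  · change binRel F FracturedRel.prec₁ a b at hab
    by_contra hsep
    -- Without a cut on the way, walking one point at a time from `a` to `b` never leaves the class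
    -- of `a`.
    have key : ∀ j : ℕ, (e a : ℕ) ≤ j → ∀ c, (e c : ℕ) = j → j ≤ e b →
        ¬ binRel F FracturedRel.prec₁ a c := by
      intro j hj
      induction j, hj using Nat.le_induction with
      | base => exact fun c hc _ => asymm (Fin.le_def.2 hc.le)
      | succ j hj ih =>
        intro c hc hjb hac
        obtain ⟨d, hd⟩ := e.surjective ⟨j, by omega⟩
        have hdj : (e d : ℕ) = j := by rw [hd]
        have hnad := ih d hdj (by omega)
        have hdc : binRel F FracturedRel.prec₁ d c :=
          hF.convex a d c ((hF.equiv_iff a d).2 ⟨hnad, asymm (Fin.le_def.2 (by omega))⟩) hac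
        exact hsep ⟨j, hj, by omega, d, c, hdj, hc, hdc⟩
    exact key (e b) (lt_of_prec hab).le b rfl le_rfl hab
  · rintro ⟨m, h1, h2, c, d, hc, hd, hcd⟩
    exact left (Fin.le_def.2 (by omega)) (right hcd (Fin.le_def.2 (by omega)))

/-- This recovers the cuts from isomorphism-invariant data. The points not `≺₁`-above `a` form the
initial segment ending with the class of `a`, so their number locates the cut after that class. -/
theorem exists_ncard_eq_iff_of_cut {n : ℕ} (cut : ℕ → Prop) {m : ℕ} (hm : m + 1 < n) :
    (∃ a : Fin n, {b : Fin n | ¬ Separated cut a b}.ncard = m + 1) ↔ cut m := by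
  have card_Iic : ∀ k : Fin n, (Set.Iic k).ncard = k + 1 := fun k => by
    rw [← Finset.coe_Iic, Set.ncard_coe_finset, Fin.card_Iic]
  have hcard := card_Iic ⟨m, by omega⟩
  simp only at hcard
  constructor
  · rintro ⟨a, ha⟩
    have hdown : ∀ {b c : Fin n}, b ≤ c → ¬ Separated cut a c → ¬ Separated cut a b :=
      fun hbc hc ⟨k, h1, h2, h3⟩ => hc ⟨k, h1, h2.trans_le hbc, h3⟩
    have h1 : ¬ Separated cut a m := by
      intro h
      have hsub : {b : Fin n | ¬ Separated cut a b} ⊂ Set.Iic (⟨m, by omega⟩ : Fin n) := by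
        refine ⟨fun b hb => ?_, fun hsub => hsub (Set.mem_Iic.2 le_rfl) h⟩
        by_contra hlt
        exact hdown (le_of_not_ge hlt) hb h
      have := Set.ncard_lt_ncard hsub (Set.toFinite _)
      omega
    have h2 : Separated cut a (m + 1) := by
      by_contra h
      have hsub : Set.Iic (⟨m + 1, hm⟩ : Fin n) ⊆ {b : Fin n | ¬ Separated cut a b} :=
        fun b hb => hdown hb h
      have := Set.ncard_le_ncard hsub (Set.toFinite _)
      have := card_Iic ⟨m + 1, hm⟩
      simp only at this
      omega
    obtain ⟨k, hk1, hk2, hk3⟩ := h2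
    rcases Nat.lt_succ_iff_lt_or_eq.1 hk2 with h | rfl
    · exact absurd ⟨k, hk1, h, hk3⟩ h1
    · exact hk3
  · intro hcut
    refine ⟨⟨m, by omega⟩, ?_⟩
    rw [← hcard]
    congr 1
    ext b
    simp only [Set.mem_ofPred_eq, Set.mem_Iic, Fin.le_def]
    exact ⟨fun h => not_lt.1 fun hlt => h ⟨m, le_rfl, hlt, hcut⟩,
      fun h ⟨k, h1, h2, _⟩ => by omega⟩

/-- The composition of size `n + 1` coded by a binary word of length `n`. -/
@[reducible] def codeComposition {n : ℕ} (b : Fin n → Bool) :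
    compositionLanguage.Structure (Fin (n + 1)) :=
  -- The final letter makes the word as long as the universe. It sits after the last point, so its
  -- value has no effect.
  cutComposition (n + 1) (wordCut (List.ofFn b ++ [true]))

theorem wordCut_ofFn_append {n : ℕ} (b : Fin n → Bool) (s : List Bool) (m : Fin n) :
    wordCut (List.ofFn b ++ s) m ↔ b m = true := by
  rw [wordCut, List.getElem?_append_left (by simp)]
  simp

/-- The unlabeled composition of size `n + 1` coded by a binary word of length `n`. -/
def unlabeledOfCode {n : ℕ} (b : Fin n → Bool) : UnlabeledStructure IsComposition (n + 1) :=
  Quotient.mk (isoSetoid IsComposition (n + 1))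
    ⟨codeComposition b, isComposition_cutComposition _ _⟩

theorem unlabeledOfCode_injective (n : ℕ) :
    Function.Injective (unlabeledOfCode (n := n)) := by
  intro b c hbc
  obtain ⟨e⟩ := Quotient.exact hbc
  obtain ⟨f, hf⟩ : ∃ f : Fin (n + 1) ≃ Fin (n + 1), ∀ i j,
      Separated (wordCut (List.ofFn c ++ [true])) (f i) (f j) ↔
        Separated (wordCut (List.ofFn b ++ [true])) i j :=
    ⟨@FirstOrder.Language.Equiv.toEquiv _ _ _ (codeComposition b) (codeComposition c) e,
      fun i j => @FirstOrder.Language.Equiv.map_rel' _ _ _ (codeComposition b) (codeComposition c) e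
        2 CompositionRel.prec₁ ![i, j]⟩
  have hcut : ∀ m : Fin n, b m = true ↔ c m = true := by
    intro m
    rw [← wordCut_ofFn_append b [true], ← wordCut_ofFn_append c [true],
      ← exists_ncard_eq_iff_of_cut (wordCut (List.ofFn b ++ [true])) (Nat.succ_lt_succ m.2),
      ← exists_ncard_eq_iff_of_cut (wordCut (List.ofFn c ++ [true])) (Nat.succ_lt_succ m.2),
      f.exists_congr_left]
    refine exists_congr fun a => ?_
    rw [← Set.ncard_image_of_injective _ f.injective]
    have : f '' {j : Fin (n + 1) | ¬ Separated (wordCut (List.ofFn b ++ [true]))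
        (f.symm a) j} =
        {j : Fin (n + 1) | ¬ Separated (wordCut (List.ofFn c ++ [true])) a j} := by
      ext j
      rw [f.image_eq_preimage_symm]
      simp only [Set.mem_preimage, Set.mem_ofPred_eq, ← hf, Equiv.apply_symm_apply]
    rw [this]
  funext m
  exact Bool.eq_iff_iff.2 (hcut m)

theorem unlabeledOfCode_surjective (n : ℕ) :
    Function.Surjective (unlabeledOfCode (n := n)) := by
  classical
  rintro ⟨S, hS⟩
  obtain ⟨cut, e, he⟩ := hS.exists_equiv_cutComposition (Fintype.card_fin _)
  refine ⟨fun m => decide (cut m), (Quotient.sound (s := isoSetoid IsComposition (n + 1)) ?_).symm⟩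
  refine hS.nonempty_equiv (isComposition_cutComposition _ _) e fun a b => ?_
  rw [he]
  -- Only gaps `m < e b ≤ n` matter, so the appended letter is never read.
  refine exists_congr fun m => and_congr_right fun _ => and_congr_right fun hm => ?_
  have := wordCut_ofFn_append (fun m : Fin n => decide (cut m)) [true] ⟨m, by omega⟩
  simp only [decide_eq_true_eq] at this
  exact this.symm

theorem satisfies_unlabeledOfCode {n : ℕ} (b : Fin n → Bool)
    (φ : compositionLanguage.Sentence) :
    (unlabeledOfCode b).Satisfies φ ↔ List.ofFn b ++ [true] ∈ wordModels φ := by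
  change @FirstOrder.Language.Sentence.Realize _ _
    (cutComposition (n + 1) (wordCut (List.ofFn b ++ [true]))) φ ↔ _
  have hlen : (List.ofFn b ++ [true]).length = n + 1 := by simp
  rw [wordModels, Set.mem_ofPred_eq, hlen]

/-- Unlabeled compositions of size `n + 1` correspond to binary words of length `n`. -/
noncomputable def codeEquiv (n : ℕ) : (Fin n → Bool) ≃ UnlabeledStructure IsComposition (n + 1) :=
  Equiv.ofBijective unlabeledOfCode ⟨unlabeledOfCode_injective n, unlabeledOfCode_surjective n⟩

theorem unlabeledProbability_succ (φ : compositionLanguage.Sentence) (n : ℕ) :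
    unlabeledProbability IsComposition φ (n + 1) =
      wordAverage n ({w | w ++ [true] ∈ wordModels φ}.indicator 1) := by
  classical
  have e : {b : Fin n → Bool // List.ofFn b ++ [true] ∈ wordModels φ} ≃
      {c : UnlabeledStructure IsComposition (n + 1) // c.Satisfies φ} :=
    (codeEquiv n).subtypeEquiv fun b => (satisfies_unlabeledOfCode b φ).symm
  rw [unlabeledProbability, ← Nat.card_congr e, ← Nat.card_congr (codeEquiv n),
    wordAverage_eq_sum, Nat.card_eq_fintype_card, Nat.card_eq_fintype_card, Fintype.card_subtype]
  simp [Set.indicator, Finset.sum_boole]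

end LogicalLimitLaw

theorem theorem5 :
    LogicalLimitLaw.AdmitsUnlabeledLimitLaw LogicalLimitLaw.IsComposition := by
  open LogicalLimitLaw in
  refine ⟨?_, fun φ => ?_⟩
  · filter_upwards [Filter.eventually_ge_atTop 1] with n hn
    obtain ⟨n, rfl⟩ := Nat.exists_eq_add_of_le' hn
    exact ⟨Finite.of_equiv _ (codeEquiv n), (codeEquiv n).nonempty_congr.1 inferInstance⟩
  · obtain ⟨p, hp⟩ := exists_tendsto_wordAverage_wordModels φ [true]
    refine ⟨p, (Filter.tendsto_add_atTop_iff_nat 1).1 ?_⟩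
    simpa only [unlabeledProbability_succ] using hp
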